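/- Let $G$ be a locally compact Hausdorff topological group acting continuously on a compact Hausdorff space $T$. A net in $G$ is wandering if it has no cluster point in $G$; a net $(g_n)$ in $G$ collapses to $a\in T$ except at $b\in T$ if for every compact $K\subseteq T\setminus\{b\}$ and every neighbourhood $U$ of $a$ one has $g_nK\subseteq U$ for all large $n$ ($a=b$ is allowed). Assume that the action has the convergence property: every wandering net in $G$ has a collapsing subnet. Let the limit set $\Lambda\subseteq T$ be the set of all $a\in T$ such that some net in $G$ collapses to $a$ except at some $b \in T$. Call a subset of $G$ bounded if it is contained in a compact subset of $G$, and let $\mathcal U^G$ be the Boolean algebra of all $A\subseteq G$ whose topological boundary is compact and for which the symmetric difference of $AK$ and $A$ is bounded for every nonempty compact $K\subseteq G$. The space of ends $E(G)$ is the set of all ultrafilters in $\mathcal U^G$ that contain no bounded set, with the action $g\cdot\mathcal F=\{gA : A\in\mathcal F\}$ and with the subspace topology from the end compactification $G\sqcup E(G)$, a base of whose topology consists of the open subsets of $G$ and the sets $A\cup\{\mathcal F\in E(G) : A\in\mathcal F\}$ for $A\in\mathcal U^G$ open in $G$. (i) If $\Lambda$ is nonempty and totally disconnected, $|T|\neq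 2$, and $G$ is not compact in case $|T|=1$, then there is a surjective $G$-equivariant continuous map $E(G)\to\Lambda$. (ii) If $\Lambda$ has more than two connected components, then $E(G)$ is infinite, i.e. $G$ has infinitely many ends. -/

import Mathlib

open scoped Pointwise

/-!
# Convergence actions and the space of ends of a locally compact group

A net is represented by the filter generated by its tails: every proper filter on `G` is the filter
of a net, a subnet corresponds to a finer proper filter, and "for `n` large enough" becomes
"eventually along the filter".
-/

section Convergence

variable {G : Type*} [Group G] {T : Type*} [TopologicalSpace T] [MulAction G T]

/-- A net on `G` (with filter `l`) collapses to `a` except at `b`: for every compact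
`K ⊆ T ∖ {b}` and every neighbourhood `U` of `a`, one has `g • K ⊆ U` for `g` far along the net. -/
def CollapsesTo (l : Filter G) (a b : T) : Prop :=
  ∀ K : Set T, IsCompact K → b ∉ K → ∀ U ∈ nhds a, ∀ᶠ g in l, g • K ⊆ U

/-- A net on a topological space is wandering if it has no cluster point. -/
def IsWandering {X : Type*} [TopologicalSpace X] (l : Filter X) : Prop :=
  ∀ x : X, ¬ ClusterPt x l

variable (G T)

/-- The convergence property: every wandering net on `G` has a collapsing subnet. -/
def IsConvergenceAction [TopologicalSpace G] : Prop :=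
  ∀ l : Filter G, l.NeBot → IsWandering l →
    ∃ l' : Filter G, l'.NeBot ∧ l' ≤ l ∧ ∃ a b : T, CollapsesTo l' a b

/-- The limit set: the points of `T` to which some net on `G` collapses. -/
def limitSet : Set T :=
  {a | ∃ b : T, ∃ l : Filter G, l.NeBot ∧ CollapsesTo l a b}

end Convergence

section Ends

/-- A subset of a topological space is bounded if it lies in a compact subset. -/
def IsBoundedSubset {X : Type*} [TopologicalSpace X] (A : Set X) : Prop :=
  ∃ K : Set X, IsCompact K ∧ A ⊆ K

/-- The Boolean algebra `𝒰^G` of subsets `A` of `G` that have compact topological boundary and are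
such that the symmetric difference of `A * K` and `A` is bounded for every nonempty compact `K`. -/
def endAlgebra (G : Type*) [Group G] [TopologicalSpace G] : Set (Set G) :=
  {A | IsCompact (frontier A) ∧
    ∀ K : Set G, IsCompact K → K.Nonempty → IsBoundedSubset (symmDiff (A * K) A)}

/-- Unbounded ultrafilters in an algebra `𝒰` of subsets of a topological space. -/
structure IsUnboundedUltrafilter {X : Type*} [TopologicalSpace X] (𝒰 ℱ : Set (Set X)) : Prop where
  subset : ℱ ⊆ 𝒰
  nonempty : ℱ.Nonempty
  inter_mem : ∀ A ∈ ℱ, ∀ B ∈ ℱ, A ∩ B ∈ ℱ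
  superset_mem : ∀ A ∈ ℱ, ∀ B ∈ 𝒰, A ⊆ B → B ∈ ℱ
  mem_or_compl_mem : ∀ A ∈ 𝒰, A ∈ ℱ ∨ Aᶜ ∈ ℱ
  not_bounded : ∀ A ∈ ℱ, ¬ IsBoundedSubset A

/-- The space of ends `E(G)`: the unbounded ultrafilters in `𝒰^G`. Its topology is the one
it has as a subspace of the end compactification, see below. -/
def EndSpace (G : Type*) [Group G] [TopologicalSpace G] : Type _ :=
  {ℱ : Set (Set G) // IsUnboundedUltrafilter (endAlgebra G) ℱ}

/-- The end compactification of `G`: as a set, the disjoint union of `G` and `E(G)`. -/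
inductive EndCompactification (G : Type*) [Group G] [TopologicalSpace G] : Type _
  | ofGroup : G → EndCompactification G
  | ofEnd : EndSpace G → EndCompactification G

/-- The topology with base the open subsets of `G` together with the sets
`A ∪ {ℱ ∈ E(G) | A ∈ ℱ}` for `A` an open member of `𝒰^G`. -/
instance EndCompactification.instTopologicalSpace (G : Type*) [Group G] [TopologicalSpace G] :
    TopologicalSpace (EndCompactification G) :=
  TopologicalSpace.generateFrom
    ({S | ∃ O : Set G, IsOpen O ∧ S = EndCompactification.ofGroup '' O} ∪
     {S | ∃ A ∈ endAlgebra G, IsOpen A ∧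
        S = EndCompactification.ofGroup '' A ∪ EndCompactification.ofEnd '' {ℱ | A ∈ ℱ.1}})

instance EndSpace.instTopologicalSpace (G : Type*) [Group G] [TopologicalSpace G] :
    TopologicalSpace (EndSpace G) :=
  TopologicalSpace.induced EndCompactification.ofEnd inferInstance

variable {G : Type*} [Group G] [TopologicalSpace G] [IsTopologicalGroup G]

theorem IsBoundedSubset.smul_set {A : Set G} (h : IsBoundedSubset A) (g : G) :
    IsBoundedSubset (g • A) := by
  obtain ⟨K, hK, hAK⟩ := h
  exact ⟨g • K, hK.smul g, Set.smul_set_mono hAK⟩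

theorem endAlgebra.smul_mem {A : Set G} (h : A ∈ endAlgebra G) (g : G) :
    g • A ∈ endAlgebra G := by
  refine ⟨?_, fun K hK hne => ?_⟩
  · have h1 : frontier (g • A) = g • frontier A :=
      ((Homeomorph.mulLeft g).image_frontier A).symm
    rw [h1]
    exact h.1.smul g
  · have h1 : symmDiff (g • A * K) (g • A) = g • symmDiff (A * K) A := by
      rw [smul_mul_assoc, Set.smul_set_symmDiff]
    rw [h1]
    exact (h.2 K hK hne).smul_set g

theorem IsUnboundedUltrafilter.smul_set {ℱ : Set (Set G)}
    (h : IsUnboundedUltrafilter (endAlgebra G) ℱ) (g : G) :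
    IsUnboundedUltrafilter (endAlgebra G) (g • ℱ) where
  subset := by
    rintro _ ⟨A, hA, rfl⟩
    exact endAlgebra.smul_mem (h.subset hA) g
  nonempty := h.nonempty.smul_set
  inter_mem := by
    rintro _ ⟨A, hA, rfl⟩ _ ⟨B, hB, rfl⟩
    exact ⟨A ∩ B, h.inter_mem A hA B hB, Set.smul_set_inter⟩
  superset_mem := by
    rintro _ ⟨A, hA, rfl⟩ B hB hAB
    refine ⟨g⁻¹ • B, h.superset_mem A hA _ (endAlgebra.smul_mem hB _) ?_, smul_inv_smul g B⟩
    exact Set.subset_smul_set_iff.2 (by simpa using hAB)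
  mem_or_compl_mem := by
    intro A hA
    rcases h.mem_or_compl_mem _ (endAlgebra.smul_mem hA g⁻¹) with h1 | h1
    · exact Or.inl ⟨_, h1, smul_inv_smul g A⟩
    · exact Or.inr ⟨_, h1, by simp [Set.smul_set_compl]⟩
  not_bounded := by
    rintro _ ⟨A, hA, rfl⟩ hb
    exact h.not_bounded A hA (by simpa using hb.smul_set g⁻¹)

/-- The action of `G` on its ends that extends left multiplication: `g • ℱ = {g • A | A ∈ ℱ}`. -/
instance EndSpace.instMulAction : MulAction G (EndSpace G) where
  smul g ℱ := ⟨g • ℱ.1, ℱ.2.smul_set g⟩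
  one_smul ℱ := Subtype.ext (one_smul G ℱ.1)
  mul_smul g h ℱ := Subtype.ext (mul_smul g h ℱ.1)

end Ends

/-! Fix three distinct points of `T`. If a net collapses to `a` except at `b`, at most one of them
equals `b`, so eventually two of the three lie in any given neighbourhood of `a`: a majority vote
detects the attracting point (`CollapsesTo.majoritySet_mem`). For clopen `C` in the limit set, the
majority set of a suitable open set containing `C` is an open `A ⊆ G` lying in exactly those
collapsing ultrafilters whose attracting point is in `C`. Bounded right multiplication preserves
attracting points, so `A` belongs to `𝒰^G` (`mem_endAlgebra_of_forall_collapsesTo`). Hence an end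
decides every clopen set of attracting points, and so determines the point itself when the limit set
is totally disconnected. In (ii) the same map is built onto the profinite space of components of the
limit set, which is infinite by a further majority argument. -/

open Filter Topology

/-! ### Wandering ultrafilters and unbounded sets -/

section Wandering

variable {X : Type*} [TopologicalSpace X]

theorem isWandering_of_le_cocompact [WeaklyLocallyCompactSpace X] {l : Filter X}
    (h : l ≤ cocompact X) : IsWandering l := by
  intro x hx
  obtain ⟨K, hK, hxK⟩ := exists_compact_mem_nhds x
  have h1 : Kᶜ ∈ l := h hK.compl_mem_cocompact
  have h2 : (𝓝 x ⊓ l).NeBot := hx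
  have h3 : K ∩ Kᶜ ∈ 𝓝 x ⊓ l := inter_mem_inf hxK h1
  rw [Set.inter_compl_self] at h3
  exact h2.ne (empty_mem_iff_bot.1 h3)

theorem IsWandering.not_isBoundedSubset {𝓕 : Ultrafilter X} (h : IsWandering (𝓕 : Filter X))
    {A : Set X} (hA : A ∈ 𝓕) : ¬ IsBoundedSubset A := by
  rintro ⟨K, hK, hAK⟩
  obtain ⟨x, -, hx⟩ := hK.ultrafilter_le_nhds 𝓕 (le_principal_iff.2 (mem_of_superset hA hAK))
  exact h x (Ultrafilter.clusterPt_iff.2 hx)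

theorem exists_ultrafilter_isWandering_of_not_isBoundedSubset [WeaklyLocallyCompactSpace X]
    {A : Set X} (hA : ¬ IsBoundedSubset A) :
    ∃ 𝓕 : Ultrafilter X, A ∈ 𝓕 ∧ IsWandering (𝓕 : Filter X) := by
  have : (cocompact X ⊓ 𝓟 A).NeBot := by
    refine ⟨fun h => hA ?_⟩
    have h1 : Aᶜ ∈ cocompact X := mem_iff_inf_principal_compl.2 (by rwa [compl_compl])
    obtain ⟨K, hK, hKA⟩ := mem_cocompact.1 h1
    exact ⟨K, hK, Set.compl_subset_compl.1 hKA⟩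
  refine ⟨Ultrafilter.of (cocompact X ⊓ 𝓟 A), ?_, ?_⟩
  · exact le_principal_iff.1 ((Ultrafilter.of_le _).trans inf_le_right)
  · exact isWandering_of_le_cocompact ((Ultrafilter.of_le _).trans inf_le_left)

end Wandering

/-! ### Collapsing filters and the limit set -/

section Collapsing

variable {G : Type*} [Group G] {T : Type*} [TopologicalSpace T] [MulAction G T]

theorem CollapsesTo.mono {l l' : Filter G} {a b : T} (h : CollapsesTo l a b) (hl : l' ≤ l) :
    CollapsesTo l' a b :=
  fun K hK hb U hU => hl (h K hK hb U hU)

theorem CollapsesTo.eventually_smul_mem {l : Filter G} {a b x : T} (h : CollapsesTo l a b)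
    (hx : x ≠ b) {U : Set T} (hU : U ∈ 𝓝 a) : ∀ᶠ g in l, g • x ∈ U := by
  filter_upwards [h {x} isCompact_singleton (by simpa using hx.symm) U hU] with g hg
  exact hg (Set.smul_mem_smul_set rfl)

theorem CollapsesTo.map_mul_left [ContinuousConstSMul G T] {l : Filter G} {a b : T}
    (h : CollapsesTo l a b) (g : G) : CollapsesTo (l.map (g * ·)) (g • a) b := by
  intro K hK hb U hU
  have h1 : (g • ·) ⁻¹' U ∈ 𝓝 a := (continuous_const_smul g).continuousAt.preimage_mem_nhds hU
  change ∀ᶠ x in l, (g * x) • K ⊆ U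
  filter_upwards [h K hK hb _ h1] with x hx
  rintro _ ⟨t, ht, rfl⟩
  change (g * x) • t ∈ U
  rw [mul_smul]
  exact hx (Set.smul_mem_smul_set ht)

/-- An ultrafilter has no strictly finer proper filter, so the collapsing subnet is the ultrafilter
itself. -/
theorem IsConvergenceAction.exists_collapsesTo [TopologicalSpace G]
    (hconv : IsConvergenceAction G T) (𝓕 : Ultrafilter G) (h : IsWandering (𝓕 : Filter G)) :
    ∃ a b : T, CollapsesTo (𝓕 : Filter G) a b := by
  obtain ⟨l, hl, hle, a, b, hab⟩ := hconv 𝓕 inferInstance h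
  exact ⟨a, b, by rwa [𝓕.unique hle] at hab⟩

theorem CollapsesTo.mem_limitSet {l : Filter G} [hl : l.NeBot] {a b : T}
    (h : CollapsesTo l a b) : a ∈ limitSet G T :=
  ⟨b, l, hl, h⟩

theorem exists_ultrafilter_collapsesTo {a : T} (ha : a ∈ limitSet G T) :
    ∃ (𝓕 : Ultrafilter G) (b : T), CollapsesTo (𝓕 : Filter G) a b := by
  obtain ⟨b, l, hl, h⟩ := ha
  exact ⟨Ultrafilter.of l, b, h.mono (Ultrafilter.of_le l)⟩

theorem smul_mem_limitSet [ContinuousConstSMul G T] {a : T} (ha : a ∈ limitSet G T) (g : G) :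
    g • a ∈ limitSet G T := by
  obtain ⟨b, l, hl, h⟩ := ha
  exact (h.map_mul_left g).mem_limitSet

end Collapsing

/-! ### Detecting the attracting point by majority -/

section Majority

variable {G : Type*} [Group G] {T : Type*} [MulAction G T]

/-- The elements of `G` that map at least two of the points `x`, `y`, `z` into `U`. -/
def majoritySet (G : Type*) [Group G] {T : Type*} [MulAction G T] (x y z : T) (U : Set T) :
    Set G :=
  {g | (g • x ∈ U ∧ g • y ∈ U) ∨ (g • x ∈ U ∧ g • z ∈ U) ∨ (g • y ∈ U ∧ g • z ∈ U)}

variable {x y z : T}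

theorem majoritySet_mono {U V : Set T} (h : U ⊆ V) :
    majoritySet G x y z U ⊆ majoritySet G x y z V := by
  rintro g (⟨h1, h2⟩ | ⟨h1, h2⟩ | ⟨h1, h2⟩)
  · exact Or.inl ⟨h h1, h h2⟩
  · exact Or.inr (Or.inl ⟨h h1, h h2⟩)
  · exact Or.inr (Or.inr ⟨h h1, h h2⟩)

theorem disjoint_majoritySet {U V : Set T} (h : Disjoint U V) :
    Disjoint (majoritySet G x y z U) (majoritySet G x y z V) := by
  have h' : ∀ t, t ∈ U → t ∉ V := fun t h1 h2 => Set.disjoint_left.1 h h1 h2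
  refine Set.disjoint_left.2 ?_
  have hx := fun g : G => h' (g • x)
  have hy := fun g : G => h' (g • y)
  have hz := fun g : G => h' (g • z)
  intro g h1 h2
  have := hx g
  have := hy g
  have := hz g
  simp only [majoritySet, Set.mem_ofPred_eq] at h1 h2
  tauto

theorem isOpen_majoritySet [TopologicalSpace G] [TopologicalSpace T] [ContinuousSMul G T]
    {U : Set T} (hU : IsOpen U) : IsOpen (majoritySet G x y z U) := by
  have h (t : T) : IsOpen {g : G | g • t ∈ U} :=
    hU.preimage (continuous_id.smul continuous_const)
  exact ((h x).inter (h y)).union (((h x).inter (h z)).union ((h y).inter (h z)))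

variable [TopologicalSpace T]

theorem CollapsesTo.majoritySet_mem (hxy : x ≠ y) (hxz : x ≠ z) (hyz : y ≠ z)
    {l : Filter G} {a b : T} (h : CollapsesTo l a b) {U : Set T} (hU : U ∈ 𝓝 a) :
    majoritySet G x y z U ∈ l := by
  by_cases hx : x = b
  · subst hx
    filter_upwards [h.eventually_smul_mem hxy.symm hU, h.eventually_smul_mem hxz.symm hU]
      with g h1 h2 using Or.inr (Or.inr ⟨h1, h2⟩)
  by_cases hy : y = b
  · subst hy
    filter_upwards [h.eventually_smul_mem hx hU, h.eventually_smul_mem hyz.symm hU]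
      with g h1 h2 using Or.inr (Or.inl ⟨h1, h2⟩)
  · filter_upwards [h.eventually_smul_mem hx hU, h.eventually_smul_mem hy hU]
      with g h1 h2 using Or.inl ⟨h1, h2⟩

theorem CollapsesTo.eq_of_majoritySet_mem [T2Space T] (hxy : x ≠ y) (hxz : x ≠ z) (hyz : y ≠ z)
    {l : Filter G} [l.NeBot] {a a' b : T} (h : CollapsesTo l a b)
    (h' : ∀ U ∈ 𝓝 a', majoritySet G x y z U ∈ l) : a = a' := by
  by_contra hne
  obtain ⟨U, V, hU, hV, hUV⟩ := t2_separation_nhds hne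
  have h1 := inter_mem (h.majoritySet_mem hxy hxz hyz hU) (h' V hV)
  rw [(disjoint_majoritySet hUV).inter_eq] at h1
  exact empty_notMem l h1

/-- By continuity, a cluster point `g` would send every point other than `b` to `a`; at least two of
the three points differ from `b`, against injectivity of `g`. -/
theorem CollapsesTo.isWandering [TopologicalSpace G] [T2Space T] [ContinuousSMul G T]
    (hxy : x ≠ y) (hxz : x ≠ z) (hyz : y ≠ z)
    {l : Filter G} {a b : T} (h : CollapsesTo l a b) : IsWandering l := by
  intro g hg
  have : (𝓝 g ⊓ l).NeBot := hg
  have key (t : T) (ht : t ≠ b) : g • t = a := by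
    have h1 : Tendsto (fun g : G => g • t) (𝓝 g ⊓ l) (𝓝 (g • t)) :=
      ((continuous_id.smul continuous_const).tendsto g).mono_left inf_le_left
    have h2 : Tendsto (fun g : G => g • t) (𝓝 g ⊓ l) (𝓝 a) := fun U hU =>
      inf_le_right (a := 𝓝 g) (h.eventually_smul_mem ht hU)
    exact tendsto_nhds_unique h1 h2
  have inj (s t : T) (hs : s ≠ b) (ht : t ≠ b) : s = t :=
    MulAction.injective g ((key s hs).trans (key t ht).symm)
  by_cases hx : x = b
  · subst hx
    exact hyz (inj y z hxy.symm hxz.symm)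
  by_cases hy : y = b
  · subst hy
    exact hxz (inj x z hx hyz.symm)
  · exact hxy (inj x y hx hy)

theorem isClosed_limitSet [TopologicalSpace G] [WeaklyLocallyCompactSpace G]
    [T2Space T] [ContinuousSMul G T] (hconv : IsConvergenceAction G T)
    (hxy : x ≠ y) (hxz : x ≠ z) (hyz : y ≠ z) : IsClosed (limitSet G T) := by
  refine isClosed_of_closure_subset fun a ha => ?_
  -- A wandering ultrafilter containing the majority sets of all neighbourhoods of `a` can only
  -- collapse to `a`. Limit points near `a` show that these conditions are compatible.
  have hne : (cocompact G ⊓ (𝓝 a).lift' (majoritySet G x y z)).NeBot := by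
    rw [← forall_mem_nonempty_iff_neBot]
    intro S hS
    obtain ⟨S₁, hS₁, S₂, hS₂, rfl⟩ := mem_inf_iff.1 hS
    obtain ⟨K, hK, hKS⟩ := mem_cocompact.1 hS₁
    obtain ⟨U, hU, hUS⟩ := (mem_lift'_sets fun _ _ => majoritySet_mono).1 hS₂
    obtain ⟨O, hOU, hO, haO⟩ := mem_nhds_iff.1 hU
    obtain ⟨c, hcO, hc⟩ := mem_closure_iff.1 ha O hO haO
    obtain ⟨𝓕, b, h𝓕⟩ := exists_ultrafilter_collapsesTo hc
    have h1 : majoritySet G x y z O ∈ 𝓕 :=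
      h𝓕.majoritySet_mem hxy hxz hyz (hO.mem_nhds hcO)
    have h2 : Kᶜ ∈ 𝓕 := by
      refine Ultrafilter.compl_mem_iff_notMem.2 fun hK' => ?_
      exact (h𝓕.isWandering hxy hxz hyz).not_isBoundedSubset hK' ⟨K, hK, subset_rfl⟩
    obtain ⟨g, hg1, hg2⟩ := 𝓕.nonempty_of_mem (inter_mem h1 h2)
    exact ⟨g, hKS hg2, hUS (majoritySet_mono hOU hg1)⟩
  let 𝓕 := Ultrafilter.of (cocompact G ⊓ (𝓝 a).lift' (majoritySet G x y z))
  have hle : (𝓕 : Filter G) ≤ cocompact G ⊓ (𝓝 a).lift' (majoritySet G x y z) :=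
    Ultrafilter.of_le _
  obtain ⟨c, b, hcb⟩ := hconv.exists_collapsesTo 𝓕
    (isWandering_of_le_cocompact (hle.trans inf_le_left))
  have : c = a := hcb.eq_of_majoritySet_mem hxy hxz hyz fun U hU =>
    hle (inf_le_right (a := cocompact G) (mem_lift' hU))
  exact this ▸ hcb.mem_limitSet

end Majority

/-! ### Right multiplication and membership in `𝒰^G` -/

section Perturbation

variable {G : Type*} [Group G] [TopologicalSpace G]
  {T : Type*} [TopologicalSpace T] [CompactSpace T] [T2Space T] [MulAction G T]
  [ContinuousSMul G T]

/-- The attracting point does not change under multiplication on the right by elements of a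
compact set. -/
theorem CollapsesTo.exists_map_mul_right {𝓕 : Ultrafilter G} {a b : T}
    (h : CollapsesTo (𝓕 : Filter G) a b) {K : Set G} (hK : IsCompact K) {κ : G → G}
    (hκ : ∀ᶠ g in 𝓕, κ g ∈ K) :
    ∃ b', CollapsesTo ((𝓕.map fun g => g * κ g : Ultrafilter G) : Filter G) a b' := by
  obtain ⟨k, -, hk⟩ := hK.ultrafilter_le_nhds (𝓕.map κ) (le_principal_iff.2 hκ)
  -- With `k` the limit of `κ g`, the sets `κ g • C` stay close to `k • C`, which avoids `b` exactly
  -- when `C` avoids `k⁻¹ • b`.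
  refine ⟨k⁻¹ • b, fun C hC hbC U hU => ?_⟩
  have hb : b ∉ k • C := fun hb => hbC (Set.mem_smul_set_iff_inv_smul_mem.1 hb)
  obtain ⟨O, N, hO, hN, hCO, hbN, hON⟩ :=
    (hC.smul k).separation_of_notMem hb
  have h1 : ∀ᶠ g in 𝓝 k, ∀ t ∈ C, g • t ∈ O := by
    refine hC.eventually_forall_of_forall_eventually fun t ht => ?_
    have : Tendsto (fun p : G × T => p.1 • p.2) (𝓝 (k, t)) (𝓝 (k • t)) :=
      continuous_smul.tendsto _
    exact this (hO.mem_nhds (hCO (Set.smul_mem_smul_set ht)))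
  have h2 : ∀ᶠ g in (𝓕 : Filter G), ∀ t ∈ C, κ g • t ∈ O := hk h1
  have h3 := h Nᶜ hN.isClosed_compl.isCompact (by simpa using hbN) U hU
  change ∀ᶠ g in (𝓕 : Filter G), (g * κ g) • C ⊆ U
  filter_upwards [h2, h3] with g hg2 hg3
  rintro _ ⟨t, ht, rfl⟩
  change (g * κ g) • t ∈ U
  rw [mul_smul]
  exact hg3 (Set.smul_mem_smul_set fun hn => Set.disjoint_left.1 hON (hg2 t ht) hn)

variable [LocallyCompactSpace G] {x y z : T}

/-- If `S` were unbounded, a wandering ultrafilter on it could be moved by elements of `K` both into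
`A` and into its complement, without changing its attracting point. -/
theorem isBoundedSubset_of_forall_mul_mem (hconv : IsConvergenceAction G T)
    {A : Set G} {C : Set T}
    (hA : ∀ (𝓕 : Ultrafilter G) (a b : T), CollapsesTo (𝓕 : Filter G) a b → (A ∈ 𝓕 ↔ a ∈ C))
    {S K : Set G} (hK : IsCompact K)
    (hS : ∀ g ∈ S, (∃ k ∈ K, g * k ∈ A) ∧ ∃ k ∈ K, g * k ∉ A) : IsBoundedSubset S := by
  by_contra hSb
  obtain ⟨𝓕, hS𝓕, hw⟩ := exists_ultrafilter_isWandering_of_not_isBoundedSubset hSb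
  obtain ⟨a, b, hab⟩ := hconv.exists_collapsesTo 𝓕 hw
  choose! κ hκK hκA using fun g hg => (hS g hg).1
  choose! μ hμK hμA using fun g hg => (hS g hg).2
  obtain ⟨b₁, hb₁⟩ := hab.exists_map_mul_right hK (mem_of_superset hS𝓕 hκK)
  obtain ⟨b₂, hb₂⟩ := hab.exists_map_mul_right hK (mem_of_superset hS𝓕 hμK)
  have h1 := (hA _ _ _ hb₁).1 (mem_of_superset hS𝓕 hκA : _ ∈ 𝓕)
  have h2 : Aᶜ ∈ 𝓕.map fun g => g * μ g := (mem_of_superset hS𝓕 hμA : _ ∈ 𝓕)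
  exact Ultrafilter.compl_mem_iff_notMem.1 h2 ((hA _ _ _ hb₂).2 h1)

theorem mem_endAlgebra_of_forall_collapsesTo [IsTopologicalGroup G]
    (hconv : IsConvergenceAction G T) {A : Set G} {C : Set T}
    (hA : ∀ (𝓕 : Ultrafilter G) (a b : T), CollapsesTo (𝓕 : Filter G) a b → (A ∈ 𝓕 ↔ a ∈ C)) :
    A ∈ endAlgebra G := by
  constructor
  · obtain ⟨K, hK, hK1⟩ := exists_compact_mem_nhds (1 : G)
    have : IsBoundedSubset (frontier A) := by
      refine isBoundedSubset_of_forall_mul_mem hconv hA hK fun g hg => ?_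
      -- The neighbourhood `g • K` of a boundary point `g` meets both `A` and its complement.
      have hgK : (fun h => g⁻¹ * h) ⁻¹' K ∈ 𝓝 g := by
        refine (continuous_const_mul g⁻¹).continuousAt.preimage_mem_nhds ?_
        simpa using hK1
      rw [frontier_eq_closure_inter_closure] at hg
      obtain ⟨p, hp, hpA⟩ := mem_closure_iff_nhds.1 hg.1 _ hgK
      obtain ⟨q, hq, hqA⟩ := mem_closure_iff_nhds.1 hg.2 _ hgK
      exact ⟨⟨_, hp, by simpa using hpA⟩, ⟨_, hq, by simpa using hqA⟩⟩
    obtain ⟨L, hL, hAL⟩ := this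
    exact hL.closure.of_isClosed_subset isClosed_frontier (hAL.trans subset_closure)
  · rintro K hK ⟨k, hk⟩
    refine isBoundedSubset_of_forall_mul_mem hconv hA (hK.inv.union (isCompact_singleton (x := 1)))
      fun g hg => ?_
    rcases hg with ⟨⟨p, hp, q, hq, rfl⟩, hg⟩ | ⟨hg, hg'⟩
    · exact ⟨⟨q⁻¹, Or.inl (Set.inv_mem_inv.2 hq), by simpa using hp⟩,
        ⟨1, Or.inr rfl, by simpa using hg⟩⟩
    · refine ⟨⟨1, Or.inr rfl, by simpa using hg⟩, ⟨k⁻¹, Or.inl (Set.inv_mem_inv.2 hk), fun h => ?_⟩⟩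
      exact hg' ⟨g * k⁻¹, h, k, hk, by simp⟩

end Perturbation

/-! ### Ends as traces of wandering ultrafilters -/

section EndUltrafilters

variable {G : Type*} [Group G] [TopologicalSpace G] [IsTopologicalGroup G]

theorem IsBoundedSubset.mono {X : Type*} [TopologicalSpace X] {A B : Set X}
    (hB : IsBoundedSubset B) (h : A ⊆ B) : IsBoundedSubset A :=
  hB.imp fun _ hK => ⟨hK.1, h.trans hK.2⟩

theorem IsBoundedSubset.union {X : Type*} [TopologicalSpace X] {A B : Set X}
    (hA : IsBoundedSubset A) (hB : IsBoundedSubset B) : IsBoundedSubset (A ∪ B) := by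
  obtain ⟨K, hK, hAK⟩ := hA
  obtain ⟨L, hL, hBL⟩ := hB
  exact ⟨K ∪ L, hK.union hL, Set.union_subset_union hAK hBL⟩

theorem IsBoundedSubset.mul {A B : Set G} (hA : IsBoundedSubset A) (hB : IsBoundedSubset B) :
    IsBoundedSubset (A * B) := by
  obtain ⟨K, hK, hAK⟩ := hA
  obtain ⟨L, hL, hBL⟩ := hB
  exact ⟨K * L, hK.mul hL, Set.mul_subset_mul hAK hBL⟩

omit [IsTopologicalGroup G] in
theorem univ_mem_endAlgebra : (Set.univ : Set G) ∈ endAlgebra G := by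
  refine ⟨by simp, fun K _ ⟨k, hk⟩ => ⟨∅, isCompact_empty, ?_⟩⟩
  rintro g (⟨-, hg⟩ | ⟨-, hg⟩)
  · exact hg trivial
  · exact hg ⟨g * k⁻¹, trivial, k, hk, by simp⟩

theorem endAlgebra.compl_mem {A : Set G} (hA : A ∈ endAlgebra G) : Aᶜ ∈ endAlgebra G := by
  refine ⟨by simpa using hA.1, fun K hK hne => ?_⟩
  -- If `p ∉ A` and `p * k ∈ A`, then `p` lies in `A * K⁻¹` but not in `A`.
  refine (((hA.2 K⁻¹ hK.inv hne.inv).mul ⟨K, hK, subset_rfl⟩).union (hA.2 K hK hne)).mono ?_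
  rintro g (⟨⟨p, hp, k, hk, rfl⟩, hg⟩ | ⟨hg, hg'⟩)
  · refine Or.inl ⟨p, Or.inl ⟨⟨p * k, not_not.1 hg, k⁻¹, Set.inv_mem_inv.2 hk, ?_⟩, hp⟩, k, hk, rfl⟩
    simp
  · obtain ⟨k, hk⟩ := hne
    refine Or.inr (Or.inl ⟨⟨g * k⁻¹, ?_, k, hk, by simp⟩, hg⟩)
    by_contra h
    exact hg' ⟨g * k⁻¹, h, k, hk, by simp⟩

omit [IsTopologicalGroup G] in
theorem endAlgebra.inter_mem {A B : Set G} (hA : A ∈ endAlgebra G) (hB : B ∈ endAlgebra G) :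
    A ∩ B ∈ endAlgebra G := by
  constructor
  · refine (hA.1.union hB.1).of_isClosed_subset isClosed_frontier ?_
    exact (frontier_inter_subset A B).trans
      (Set.union_subset_union Set.inter_subset_left Set.inter_subset_right)
  rintro K hK ⟨k, hk⟩
  have hne : K.Nonempty := ⟨k, hk⟩
  -- Translation by the single element `k` commutes with intersections, unlike multiplication by
  -- `K`.
  have hk' := isCompact_singleton (x := k)
  refine (((hA.2 K hK hne).union (hB.2 K hK hne)).union
    ((hA.2 {k} hk' (by simp)).union (hB.2 {k} hk' (by simp)))).mono ?_
  rintro g (⟨⟨p, hp, q, hq, rfl⟩, hg⟩ | ⟨hg, hg'⟩)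
  · refine Or.inl ?_
    by_cases h : p * q ∈ A
    · exact Or.inr (Or.inl ⟨⟨p, hp.2, q, hq, rfl⟩, fun h' => hg ⟨h, h'⟩⟩)
    · exact Or.inl (Or.inl ⟨⟨p, hp.1, q, hq, rfl⟩, h⟩)
  · refine Or.inr ?_
    have mem_mul (D : Set G) (h : g ∈ D * {k}) : g * k⁻¹ ∈ D := by
      obtain ⟨p, hp, _, rfl, rfl⟩ := h
      simpa using hp
    by_cases h : g * k⁻¹ ∈ A
    · refine Or.inr (Or.inr ⟨hg.2, fun h' => hg' ⟨g * k⁻¹, ⟨h, mem_mul B h'⟩, k, hk, by simp⟩⟩)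
    · exact Or.inl (Or.inr ⟨hg.1, fun h' => h (mem_mul A h')⟩)

/-- The end defined by a wandering ultrafilter. -/
def EndSpace.ofUltrafilter (𝓕 : Ultrafilter G) (h : IsWandering (𝓕 : Filter G)) : EndSpace G :=
  ⟨{A | A ∈ endAlgebra G ∧ A ∈ 𝓕}, {
    subset := fun _ hA => hA.1
    nonempty := ⟨Set.univ, univ_mem_endAlgebra, univ_mem⟩
    inter_mem := fun _ hA _ hB => ⟨endAlgebra.inter_mem hA.1 hB.1, Filter.inter_mem hA.2 hB.2⟩
    superset_mem := fun _ hA _ hB hAB => ⟨hB, mem_of_superset hA.2 hAB⟩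
    mem_or_compl_mem := fun A hA => (𝓕.mem_or_compl_mem A).imp (fun h => ⟨hA, h⟩)
      fun h => ⟨endAlgebra.compl_mem hA, h⟩
    not_bounded := fun _ hA => h.not_isBoundedSubset hA.2 }⟩

omit [IsTopologicalGroup G] in
theorem EndSpace.isOpen_setOf_mem {A : Set G} (hA : A ∈ endAlgebra G) (hAo : IsOpen A) :
    IsOpen {e : EndSpace G | A ∈ e.1} := by
  refine isOpen_induced_iff.2 ⟨EndCompactification.ofGroup '' A ∪
    EndCompactification.ofEnd '' {e | A ∈ e.1},
    TopologicalSpace.isOpen_generateFrom_of_mem (Or.inr ⟨A, hA, hAo, rfl⟩), ?_⟩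
  ext e
  simp

theorem IsCompact.mem_endAlgebra [T2Space G] {K : Set G} (hK : IsCompact K) :
    K ∈ endAlgebra G := by
  refine ⟨hK.of_isClosed_subset isClosed_frontier hK.isClosed.frontier_subset, fun L hL _ => ?_⟩
  exact ⟨K * L ∪ K, (hK.mul hL).union hK, Set.symmDiff_subset_union⟩

/-- Every end is the trace on `𝒰^G` of a wandering ultrafilter. -/
theorem EndSpace.exists_ultrafilter [LocallyCompactSpace G] [T2Space G] (e : EndSpace G) :
    ∃ 𝓕 : Ultrafilter G, (∀ A ∈ e.1, A ∈ 𝓕) ∧ IsWandering (𝓕 : Filter G) := by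
  let l : Filter G :=
    { sets := {S | ∃ A ∈ e.1, A ⊆ S}
      univ_sets := e.2.nonempty.imp fun A hA => ⟨hA, Set.subset_univ A⟩
      sets_of_superset := fun ⟨A, hA, hAS⟩ h => ⟨A, hA, hAS.trans h⟩
      inter_sets := fun ⟨A, hA, hAS⟩ ⟨B, hB, hBS⟩ =>
        ⟨A ∩ B, e.2.inter_mem A hA B hB, Set.inter_subset_inter hAS hBS⟩ }
  have hl : l.NeBot := by
    refine neBot_iff.2 fun h => ?_
    obtain ⟨A, hA, hA'⟩ := empty_mem_iff_bot.2 h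
    exact e.2.not_bounded A hA ⟨∅, isCompact_empty, hA'⟩
  have hmem : ∀ A ∈ e.1, A ∈ Ultrafilter.of l := fun A hA =>
    Ultrafilter.of_le l ⟨A, hA, subset_rfl⟩
  refine ⟨Ultrafilter.of l, hmem, isWandering_of_le_cocompact fun S hS => ?_⟩
  obtain ⟨K, hK, hKS⟩ := mem_cocompact.1 hS
  refine mem_of_superset (hmem Kᶜ ?_) hKS
  exact (e.2.mem_or_compl_mem K hK.mem_endAlgebra).resolve_left
    fun h => e.2.not_bounded K h ⟨K, hK, subset_rfl⟩

end EndUltrafilters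

/-! ### The map on ends and the number of components -/

section EndMap

variable {G : Type*} [Group G] [TopologicalSpace G] [IsTopologicalGroup G]
  [LocallyCompactSpace G] [T2Space G]
  {T : Type*} [TopologicalSpace T] [CompactSpace T] [T2Space T] [MulAction G T]
  [ContinuousSMul G T] {x y z : T}

omit [T2Space G] in
/-- Clopen subsets of the limit set are traces of open members of `𝒰^G`. -/
theorem exists_isOpen_mem_endAlgebra (hconv : IsConvergenceAction G T)
    (hxy : x ≠ y) (hxz : x ≠ z) (hyz : y ≠ z) {C : Set (limitSet G T)} (hC : IsClopen C) :
    ∃ A ∈ endAlgebra G, IsOpen A ∧ ∀ (𝓕 : Ultrafilter G) (a : limitSet G T) (b : T),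
      CollapsesTo (𝓕 : Filter G) (a : T) b → (A ∈ 𝓕 ↔ a ∈ C) := by
  have hΛ := isClosed_limitSet hconv hxy hxz hyz
  have : CompactSpace (limitSet G T) := isCompact_iff_compactSpace.1 hΛ.isCompact
  obtain ⟨U, V, hU, hV, hCU, hCV, hUV⟩ :
      SeparatedNhds (Subtype.val '' C) (Subtype.val '' Cᶜ) := by
    refine SeparatedNhds.of_isCompact_isCompact
      (hC.1.isCompact.image continuous_subtype_val)
      (hC.compl.1.isCompact.image continuous_subtype_val) ?_
    exact (Set.disjoint_image_iff Subtype.val_injective).2 disjoint_compl_right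
  have key (𝓕 : Ultrafilter G) (a : limitSet G T) (b : T)
      (h : CollapsesTo (𝓕 : Filter G) (a : T) b) : majoritySet G x y z U ∈ 𝓕 ↔ a ∈ C := by
    refine ⟨fun hA => ?_, fun ha => ?_⟩
    · by_contra ha
      have h1 : majoritySet G x y z V ∈ 𝓕 :=
        h.majoritySet_mem hxy hxz hyz (hV.mem_nhds (hCV ⟨a, ha, rfl⟩))
      have h2 := inter_mem hA h1
      rw [(disjoint_majoritySet hUV).inter_eq] at h2
      exact 𝓕.empty_notMem h2
    · exact h.majoritySet_mem hxy hxz hyz (hU.mem_nhds (hCU ⟨a, ha, rfl⟩))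
  refine ⟨_, mem_endAlgebra_of_forall_collapsesTo (C := Subtype.val '' C) hconv fun 𝓕 a b h => ?_,
    isOpen_majoritySet hU, key⟩
  rw [key 𝓕 ⟨a, h.mem_limitSet⟩ b h]
  simp [h.mem_limitSet]

/-- A continuous surjection of the limit set onto a totally disconnected space factors through
the map that sends an end to the points to which it collapses. -/
theorem exists_continuous_surjective_endSpace (hconv : IsConvergenceAction G T)
    (hxy : x ≠ y) (hxz : x ≠ z) (hyz : y ≠ z)
    {X : Type*} [TopologicalSpace X] [CompactSpace X] [T2Space X] [TotallyDisconnectedSpace X]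
    {p : limitSet G T → X} (hp : Continuous p) (hps : Function.Surjective p) :
    ∃ f : EndSpace G → X, Continuous f ∧ Function.Surjective f ∧
      ∀ (e : EndSpace G) (𝓕 : Ultrafilter G) (a : limitSet G T) (b : T), (∀ A ∈ e.1, A ∈ 𝓕) →
        CollapsesTo (𝓕 : Filter G) (a : T) b → f e = p a := by
  have hex (e : EndSpace G) : ∃ (𝓕 : Ultrafilter G) (a : limitSet G T) (b : T),
      (∀ A ∈ e.1, A ∈ 𝓕) ∧ CollapsesTo (𝓕 : Filter G) (a : T) b := by
    obtain ⟨𝓕, h1, h2⟩ := e.exists_ultrafilter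
    obtain ⟨a, b, hab⟩ := hconv.exists_collapsesTo 𝓕 h2
    exact ⟨𝓕, ⟨a, hab.mem_limitSet⟩, b, h1, hab⟩
  have hclopen {C : Set X} (hC : IsClopen C) : ∃ A ∈ endAlgebra G, IsOpen A ∧
      ∀ (e : EndSpace G) (𝓕 : Ultrafilter G) (a : limitSet G T) (b : T), (∀ A ∈ e.1, A ∈ 𝓕) →
        CollapsesTo (𝓕 : Filter G) (a : T) b → (A ∈ e.1 ↔ p a ∈ C) := by
    obtain ⟨A, hA, hAo, hAC⟩ := exists_isOpen_mem_endAlgebra hconv hxy hxz hyz (hC.preimage hp)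
    refine ⟨A, hA, hAo, fun e 𝓕 a b h hab => ⟨fun hAe => (hAC 𝓕 a b hab).1 (h A hAe), fun ha => ?_⟩⟩
    refine (e.2.mem_or_compl_mem A hA).resolve_right fun hAe => ?_
    exact Ultrafilter.compl_mem_iff_notMem.1 (h _ hAe) ((hAC 𝓕 a b hab).2 ha)
  choose 𝓕 a b h𝓕 hab using hex
  have hf (e : EndSpace G) (𝓖 : Ultrafilter G) (a' : limitSet G T) (b' : T)
      (h : ∀ A ∈ e.1, A ∈ 𝓖) (hab' : CollapsesTo (𝓖 : Filter G) (a' : T) b') :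
      p (a e) = p a' := by
    by_contra hne
    -- A clopen set separating two candidate values would have to be decided in both ways by the
    -- same end.
    obtain ⟨C, hC, h1, h2⟩ := exists_isClopen_of_totally_separated hne
    obtain ⟨A, -, -, hAC⟩ := hclopen hC
    exact h2 ((hAC e 𝓖 a' b' h hab').1 ((hAC e (𝓕 e) (a e) (b e) (h𝓕 e) (hab e)).2 h1))
  refine ⟨fun e => p (a e), ?_, fun q => ?_, hf⟩
  · refine isTopologicalBasis_isClopen.continuous_iff.2 fun C hC => ?_
    obtain ⟨A, hA, hAo, hAC⟩ := hclopen hC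
    convert EndSpace.isOpen_setOf_mem hA hAo using 1
    ext e
    exact (hAC e (𝓕 e) (a e) (b e) (h𝓕 e) (hab e)).symm
  · obtain ⟨⟨c, hc⟩, rfl⟩ := hps q
    obtain ⟨𝓖, d, hcd⟩ := exists_ultrafilter_collapsesTo hc
    exact ⟨EndSpace.ofUltrafilter 𝓖 (hcd.isWandering hxy hxz hyz),
      hf _ 𝓖 ⟨c, hc⟩ d (fun A hA => hA.2) hcd⟩

omit [T2Space G] in
theorem EndSpace.nonempty [NoncompactSpace G] : Nonempty (EndSpace G) :=
  ⟨EndSpace.ofUltrafilter (Ultrafilter.of (cocompact G))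
    (isWandering_of_le_cocompact (Ultrafilter.of_le _))⟩

omit [IsTopologicalGroup G] [T2Space G] in
/-- A limit set with at least three components has infinitely many. -/
theorem infinite_connectedComponents_limitSet (hconv : IsConvergenceAction G T)
    {x y z : limitSet G T} (hxy : (x : ConnectedComponents (limitSet G T)) ≠ y)
    (hxz : (x : ConnectedComponents (limitSet G T)) ≠ z)
    (hyz : (y : ConnectedComponents (limitSet G T)) ≠ z) :
    Infinite (ConnectedComponents (limitSet G T)) := by
  by_contra hfin
  rw [not_infinite_iff_finite] at hfin
  have hne {s t : limitSet G T} (h : (s : ConnectedComponents (limitSet G T)) ≠ t) :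
      (s : T) ≠ t := fun h' => h (congrArg _ (Subtype.ext h'))
  have hΛ := isClosed_limitSet hconv (hne hxy) (hne hxz) (hne hyz)
  have : CompactSpace (limitSet G T) := isCompact_iff_compactSpace.1 hΛ.isCompact
  obtain ⟨𝓕, b, hab⟩ := exists_ultrafilter_collapsesTo x.2
  -- Finitely many components form a discrete space, so the component of `x` is open.
  have hC : IsOpen ((↑) ⁻¹' {(x : ConnectedComponents (limitSet G T))} : Set (limitSet G T)) :=
    (isOpen_discrete _).preimage ConnectedComponents.continuous_coe
  obtain ⟨U, hU, hUC⟩ := isOpen_induced_iff.1 hC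
  have hxU : (x : T) ∈ U := by
    have : x ∈ Subtype.val ⁻¹' U := hUC ▸ rfl
    exact this
  -- Some `g` moves two of the three points into the component of `x`; applying `g⁻¹` puts those two
  -- in a common component.
  obtain ⟨g, hg⟩ := 𝓕.nonempty_of_mem
    (hab.majoritySet_mem (hne hxy) (hne hxz) (hne hyz) (hU.mem_nhds hxU))
  let φ (h : G) (s : limitSet G T) : limitSet G T := ⟨h • (s : T), smul_mem_limitSet s.2 h⟩
  have hφ (h : G) : Continuous (φ h) :=
    (continuous_subtype_val.const_smul h).subtype_mk _
  have key (s t : limitSet G T) (hs : g • (s : T) ∈ U) (ht : g • (t : T) ∈ U) :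
      (s : ConnectedComponents (limitSet G T)) = t := by
    have hs' : φ g s ∈ Subtype.val ⁻¹' U := hs
    have ht' : φ g t ∈ Subtype.val ⁻¹' U := ht
    rw [hUC] at hs' ht'
    have h1 : (φ g s : ConnectedComponents (limitSet G T)) = φ g t :=
      Eq.trans hs' (Eq.symm ht')
    have h2 := congrArg (hφ g⁻¹).connectedComponentsMap h1
    have h3 (r : limitSet G T) : φ g⁻¹ (φ g r) = r := Subtype.ext (inv_smul_smul g (r : T))
    change ((φ g⁻¹ (φ g s) : limitSet G T) : ConnectedComponents (limitSet G T)) =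
      (φ g⁻¹ (φ g t) : limitSet G T) at h2
    rwa [h3, h3] at h2
  rcases hg with ⟨h1, h2⟩ | ⟨h1, h2⟩ | ⟨h1, h2⟩
  · exact hxy (key x y h1 h2)
  · exact hxz (key x z h1 h2)
  · exact hyz (key y z h1 h2)

end EndMap

theorem exists_ne_of_two_lt_card {α : Type*} (h : 2 < ENat.card α) :
    ∃ x y z : α, x ≠ y ∧ x ≠ z ∧ y ≠ z := by
  have h3 : (3 : ℕ∞) ≤ (Set.univ : Set α).encard := by
    rw [Set.encard_univ]
    exact Order.add_one_le_of_lt h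
  obtain ⟨t, -, ht⟩ := Set.exists_subset_encard_eq h3
  obtain ⟨x, y, z, hxy, hxz, hyz, -⟩ := Set.encard_eq_three.1 ht
  exact ⟨x, y, z, hxy, hxz, hyz⟩

theorem mainTheorem2 {G : Type*} [Group G] [TopologicalSpace G] [IsTopologicalGroup G]
    [LocallyCompactSpace G] [T2Space G]
    {T : Type*} [TopologicalSpace T] [CompactSpace T] [T2Space T]
    [MulAction G T] [ContinuousSMul G T]
    (hconv : IsConvergenceAction G T) :
    ((limitSet G T).Nonempty → IsTotallyDisconnected (limitSet G T) → ENat.card T ≠ 2 →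
      (ENat.card T = 1 → NoncompactSpace G) →
      ∃ f : EndSpace G → limitSet G T, Continuous f ∧ Function.Surjective f ∧
        ∀ (g : G) (e : EndSpace G), ((f (g • e) : limitSet G T) : T) = g • ((f e : limitSet G T) : T)) ∧
    (2 < ENat.card (ConnectedComponents (limitSet G T)) → Infinite (EndSpace G)) := by
  constructor
  · intro hΛne htd h2 h1
    by_cases h3 : 2 < ENat.card T
    · obtain ⟨x, y, z, hxy, hxz, hyz⟩ := exists_ne_of_two_lt_card h3
      have : CompactSpace (limitSet G T) :=
        isCompact_iff_compactSpace.1 (isClosed_limitSet hconv hxy hxz hyz).isCompact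
      have : TotallyDisconnectedSpace (limitSet G T) :=
        totallyDisconnectedSpace_subtype_iff.2 htd
      obtain ⟨f, hf, hfs, hfc⟩ := exists_continuous_surjective_endSpace hconv hxy hxz hyz
        (p := (id : limitSet G T → limitSet G T)) continuous_id Function.surjective_id
      refine ⟨f, hf, hfs, fun g e => ?_⟩
      obtain ⟨𝓕, he, hw⟩ := e.exists_ultrafilter
      obtain ⟨a, b, hab⟩ := hconv.exists_collapsesTo 𝓕 hw
      have hga := hab.map_mul_left g
      rw [hfc e 𝓕 ⟨a, hab.mem_limitSet⟩ b he hab,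
        hfc (g • e) (𝓕.map (g * ·)) ⟨g • a, smul_mem_limitSet hab.mem_limitSet g⟩ b ?_ hga]
      · rfl
      · rintro _ ⟨A, hA, rfl⟩
        change (g * ·) ⁻¹' ((g • ·) '' A) ∈ 𝓕
        exact mem_of_superset (he A hA) fun x hx => ⟨x, hx, rfl⟩
    · obtain ⟨a, ha⟩ := hΛne
      -- Here `T` is a single point, and any end serves to make the constant map surjective.
      have hlt : ENat.card T < 2 := lt_of_le_of_ne (not_lt.1 h3) h2
      have hle : ENat.card T ≤ 1 := Order.le_of_lt_add_one hlt
      have : Subsingleton T := ENat.card_le_one_iff_subsingleton T |>.1 hle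
      have : Nonempty T := ⟨a⟩
      have := h1 (le_antisymm hle ((ENat.one_le_card_iff_nonempty T).2 this))
      obtain ⟨e⟩ := EndSpace.nonempty (G := G)
      exact ⟨fun _ => ⟨a, ha⟩, continuous_const, fun c => ⟨e, Subsingleton.elim _ _⟩,
        fun g e => Subsingleton.elim _ _⟩
  · intro h
    obtain ⟨u, v, w, huv, huw, hvw⟩ := exists_ne_of_two_lt_card h
    obtain ⟨x, rfl⟩ := ConnectedComponents.surjective_coe u
    obtain ⟨y, rfl⟩ := ConnectedComponents.surjective_coe v
    obtain ⟨z, rfl⟩ := ConnectedComponents.surjective_coe w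
    have hne {s t : limitSet G T} (h : (s : ConnectedComponents (limitSet G T)) ≠ t) :
        (s : T) ≠ t := fun h' => h (congrArg _ (Subtype.ext h'))
    have : CompactSpace (limitSet G T) := isCompact_iff_compactSpace.1
      (isClosed_limitSet hconv (hne huv) (hne huw) (hne hvw)).isCompact
    have := infinite_connectedComponents_limitSet hconv huv huw hvw
    obtain ⟨f, -, hf, -⟩ := exists_continuous_surjective_endSpace hconv (hne huv) (hne huw)
      (hne hvw) ConnectedComponents.continuous_coe ConnectedComponents.surjective_coe
    exact Infinite.of_surjective f hf
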